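/- Let $b\in\mathbb{Z}$ and $c=-b^2$ with $c\notin\{0,-1\}$, and let $L_c$ be the splitting field over $\mathbb{Q}$ of $f_c(f_c(x))=(x^2+c)^2+c$, where $f_c(x)=x^2+c$. Then $L_c=\mathbb{Q}(\sqrt{b^2+b},\sqrt{b^2-b})$ is a field of degree $4$ over $\mathbb{Q}$. Write $2\mathcal{O}_{L_c}=\prod_{i=1}^{g}\mathfrak{p}_i^{e}$ with $\mathfrak{p}_1,\dots,\mathfrak{p}_g$ distinct prime ideals of the ring of integers $\mathcal{O}_{L_c}$, with common residue degree $f=[\mathcal{O}_{L_c}/\mathfrak{p}_i:\mathbb{Z}/2\mathbb{Z}]$. Then: 1. $(e,f,g)=(4,1,1)$ if and only if at least one of the following holds: - $b\equiv\pm3,\pm7,\pm13\pmod{32}$; - $b\equiv\pm15\pmod{64}$; - $b=\pm4^{j}(4r+2)$ for some integers $j\ge0$ and $r$; - $b=\pm(1+4^{k}(4r+3))$ for some integers $k\ge2$ and $r$; - $b=\pm(1+4^{k}(8r+6))$ for some integers $k\ge2$ and $r$. 2. $(e,f,g)=(2,2,1)$ if and only if at least one of the following holds: - $b\equiv\pm4,\pm5\pmod{32}$;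 - $b\equiv\pm9\pmod{64}$; - $b=\pm4^{k}(8r+3)$ for some integers $k\ge2$ and $r$; - $b=\pm(1+4^{k}(8r+5))$ for some integers $k\ge2$ and $r$; - $b=\pm(1+4^{k}(16r+10))$ for some integers $k\ge2$ and $r$. 3. $(e,f,g)=(2,1,2)$ if and only if at least one of the following holds: - $b\equiv\pm11,\pm12\pmod{32}$; - $b\equiv\pm23\pmod{64}$; - $b=\pm4^{k}(8r+1)$ for some integers $k\ge2$ and $r$; - $b=\pm(1+4^{k}(8r+1))$ for some integers $k\ge2$ and $r$; - $b=\pm(1+4^{k}(16r+2))$ for some integers $k\ge2$ and $r$. These three triples are the only possibilities for $(e,f,g)$. -/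

import Mathlib

open Polynomial NumberField
open scoped IntermediateField

/-- The quadratic polynomial `f_c(x) = x ^ 2 + c`, with rational coefficients. -/
noncomputable def fPoly (c : ℤ) : ℚ[X] := X ^ 2 + C (c : ℚ)

/-- The second iterate `f_c(f_c(x))`, i.e. `(x ^ 2 + c) ^ 2 + c`. -/
noncomputable def fPolySecondIterate (c : ℤ) : ℚ[X] := (fPoly c).comp (fPoly c)

/-- In the ring of integers of `L`, the ideal generated by `2` is `(𝔭₁ ⋯ 𝔭_g) ^ e` with
`𝔭₁, …, 𝔭_g` distinct prime ideals, each of residue degree `f`. -/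
def TwoFactorsAs (L : Type*) [Field L] [NumberField L] (e f g : ℕ) : Prop :=
  ∃ P : Fin g → Ideal (𝓞 L),
    Function.Injective P ∧
    (∀ i, (P i).IsPrime ∧ (P i).inertiaDeg ℤ = f) ∧
    Ideal.span {(2 : 𝓞 L)} = ∏ i, P i ^ e

/-- `b ≡ a` or `b ≡ -a` modulo `n`. -/
def ModEqPM (n b a : ℤ) : Prop := b ≡ a [ZMOD n] ∨ b ≡ -a [ZMOD n]

/-- `b = a` or `b = -a`. -/
def EqPM (b a : ℤ) : Prop := b = a ∨ b = -a

/-- The conditions on `b` attached to `(e, f, g) = (4, 1, 1)`. -/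
def Cond411 (b : ℤ) : Prop :=
  (ModEqPM 32 b 3 ∨ ModEqPM 32 b 7 ∨ ModEqPM 32 b 13) ∨
  ModEqPM 64 b 15 ∨
  (∃ (j : ℕ) (r : ℤ), EqPM b (4 ^ j * (4 * r + 2))) ∨
  (∃ (k : ℕ) (r : ℤ), 2 ≤ k ∧ EqPM b (1 + 4 ^ k * (4 * r + 3))) ∨
  (∃ (k : ℕ) (r : ℤ), 2 ≤ k ∧ EqPM b (1 + 4 ^ k * (8 * r + 6)))

/-- The conditions on `b` attached to `(e, f, g) = (2, 2, 1)`. -/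
def Cond221 (b : ℤ) : Prop :=
  (ModEqPM 32 b 4 ∨ ModEqPM 32 b 5) ∨
  ModEqPM 64 b 9 ∨
  (∃ (k : ℕ) (r : ℤ), 2 ≤ k ∧ EqPM b (4 ^ k * (8 * r + 3))) ∨
  (∃ (k : ℕ) (r : ℤ), 2 ≤ k ∧ EqPM b (1 + 4 ^ k * (8 * r + 5))) ∨
  (∃ (k : ℕ) (r : ℤ), 2 ≤ k ∧ EqPM b (1 + 4 ^ k * (16 * r + 10)))

/-- The conditions on `b` attached to `(e, f, g) = (2, 1, 2)`. -/
def Cond212 (b : ℤ) : Prop :=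
  (ModEqPM 32 b 11 ∨ ModEqPM 32 b 12) ∨
  ModEqPM 64 b 23 ∨
  (∃ (k : ℕ) (r : ℤ), 2 ≤ k ∧ EqPM b (4 ^ k * (8 * r + 1))) ∨
  (∃ (k : ℕ) (r : ℤ), 2 ≤ k ∧ EqPM b (1 + 4 ^ k * (8 * r + 1))) ∨
  (∃ (k : ℕ) (r : ℤ), 2 ≤ k ∧ EqPM b (1 + 4 ^ k * (16 * r + 2)))

/-!
Since `f_c(f_c(x)) = (x ^ 2 - (b ^ 2 + b)) * (x ^ 2 - (b ^ 2 - b))` for `c = -b ^ 2`, the field `L`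
is generated by square roots of `b ^ 2 + b` and `b ^ 2 - b`. For `b ≠ 0, ±1` the integers
`b ^ 2 + b`, `b ^ 2 - b` and `b ^ 2 - 1` (the square class of their product) are not squares, so
`L` is biquadratic (`finrank_eq_four`), hence Galois, and `2` factors as `(𝔭₁ ⋯ 𝔭_g) ^ e` with a
common residue degree `f`. The triple `(e, f, g)` is unique and satisfies `e * f * g = 4`
(`TwoFactorsAs.unique`, `TwoFactorsAs.mul_eq`).

It is therefore enough to bound `e`, `f` and `g` from below, which elementary elements of the ring
of integers do, without completions. If `γ ^ k` is `2` times an element outside a prime above `2`,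
then `k` divides `e` (`dvd_exponent`). This gives `2 ∣ e` as soon as `L` contains `√u` with
`u ≡ 3 mod 4` or `√(2w)` with `w` odd, one of which is always the case, and `4 ∣ e` when both occur
(`TwoFactorsAs.four_dvd`). If `L` contains `√d` with `d ≡ 5 mod 8`, then `f` is even, because
`(1 + √d) / 2` reduces to a primitive cube root of unity (`TwoFactorsAs.two_dvd_inertiaDeg`). If `L`
contains `√d` with `d ≡ 1 mod 8` not a square, then `2` splits, so `2 ≤ g`
(`TwoFactorsAs.two_le_card`).

What remains is arithmetic modulo powers of `2`: each of the three lists of conditions on `b`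
provides the corresponding square classes among those of `b ^ 2 + b`, `b ^ 2 - b`, `b ^ 2 - 1`, and
the three lists together cover every `b ≠ 0, ±1` (`cond_cover`). Uniqueness of `(e, f, g)` then
turns the three implications into equivalences.
-/

/-! ### Factorizations of `2` in a number field -/

section Factorization

variable {L : Type*} [Field L]

theorem liesOver_span_two {Q : Ideal (𝓞 L)} (hQ : Q.IsPrime) (h2 : (2 : 𝓞 L) ∈ Q) :
    Q.LiesOver (Ideal.span {(2 : ℤ)}) := by
  have hmax : (Ideal.span {(2 : ℤ)}).IsMaximal :=
    PrincipalIdealRing.isMaximal_of_irreducible Int.prime_two.irreducible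
  refine ⟨hmax.eq_of_le (hQ.comap _).ne_top ?_⟩
  rw [Ideal.span_singleton_le_iff_mem, Ideal.mem_comap]
  simpa using h2

theorem intCast_notMem_of_odd {Q : Ideal (𝓞 L)} (hQ : Q.IsPrime) (h2 : (2 : 𝓞 L) ∈ Q)
    {n : ℤ} (hn : Odd n) : (n : 𝓞 L) ∉ Q := by
  obtain ⟨k, rfl⟩ := hn
  intro h
  refine hQ.ne_top ((Ideal.eq_top_iff_one _).2 ?_)
  have h3 := Q.sub_mem h (Q.mul_mem_right (k : 𝓞 L) h2)
  have h4 : (1 : 𝓞 L) = ((2 * k + 1 : ℤ) : 𝓞 L) - 2 * k := by push_cast; ring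
  rwa [h4]

variable [NumberField L]

theorem absNorm_span_two :
    Ideal.absNorm (Ideal.span {(2 : 𝓞 L)}) = 2 ^ Module.finrank ℚ L := by
  have h := Algebra.norm_algebraMap (S := 𝓞 L) (2 : ℤ)
  rw [Ideal.absNorm_span_singleton]
  simp only [map_ofNat] at h
  rw [h, RingOfIntegers.rank, Int.natAbs_pow]
  rfl

theorem span_two_ne_top : Ideal.span {(2 : 𝓞 L)} ≠ ⊤ := by
  intro h
  have h1 := absNorm_span_two (L := L)
  rw [h, Ideal.absNorm_top] at h1
  have h2 := Nat.one_lt_two_pow (Module.finrank_pos (R := ℚ) (M := L)).ne'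
  omega

theorem absNorm_eq_two_pow {Q : Ideal (𝓞 L)} (hQ : Q.IsPrime) (h2 : (2 : 𝓞 L) ∈ Q) :
    Ideal.absNorm Q = 2 ^ Q.inertiaDeg ℤ := by
  have := liesOver_span_two hQ h2
  have := Ideal.natAbs_pow_inertiaDeg (2 : ℤ) Q
  exact this.symm

variable {e f g : ℕ} {P : Fin g → Ideal (𝓞 L)}

theorem exponent_ne_zero (h : Ideal.span {(2 : 𝓞 L)} = ∏ i, P i ^ e) : e ≠ 0 := by
  rintro rfl
  exact span_two_ne_top (L := L) (by simp [h])

theorem card_ne_zero (h : Ideal.span {(2 : 𝓞 L)} = ∏ i, P i ^ e) : g ≠ 0 := by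
  rintro rfl
  exact span_two_ne_top (L := L) (by simp [h])

theorem two_mem_factor (h : Ideal.span {(2 : 𝓞 L)} = ∏ i, P i ^ e) (i : Fin g) :
    (2 : 𝓞 L) ∈ P i := by
  rw [← Ideal.span_singleton_le_iff_mem, h]
  exact Ideal.le_of_dvd ((dvd_pow_self _ (exponent_ne_zero h)).trans
    (Finset.dvd_prod_of_mem _ (Finset.mem_univ i)))

/-- Every prime ideal above `2` occurs among the factors. -/
theorem exists_eq_factor (hP : ∀ i, (P i).IsPrime)
    (h : Ideal.span {(2 : 𝓞 L)} = ∏ i, P i ^ e) {Q : Ideal (𝓞 L)} (hQ : Q.IsPrime)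
    (h2 : (2 : 𝓞 L) ∈ Q) : ∃ i, P i = Q := by
  rw [← Ideal.span_singleton_le_iff_mem, h, Ideal.IsPrime.prod_le hQ] at h2
  obtain ⟨i, -, hi⟩ := h2
  refine ⟨i, ?_⟩
  have hbot : P i ≠ ⊥ := by
    intro hb
    have := two_mem_factor h i
    rw [hb] at this
    simp at this
  exact ((hP i).isMaximal hbot).eq_of_le hQ.ne_top (hQ.le_of_pow_le hi)

/-- The fundamental identity, obtained by taking absolute norms in the factorization of `2`. -/
theorem mul_mul_eq_finrank (hP : ∀ i, (P i).IsPrime ∧ (P i).inertiaDeg ℤ = f)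
    (h : Ideal.span {(2 : 𝓞 L)} = ∏ i, P i ^ e) : e * f * g = Module.finrank ℚ L := by
  -- both sides of the factorization have norm a power of `2`; the exponents are compared
  have h1 := absNorm_span_two (L := L)
  rw [h, map_prod] at h1
  have h3 : ∀ i, Ideal.absNorm (P i ^ e) = 2 ^ (f * e) := fun i => by
    rw [map_pow, absNorm_eq_two_pow (hP i).1 (two_mem_factor h i), (hP i).2, pow_mul]
  simp only [h3, Finset.prod_const, Finset.card_univ, Fintype.card_fin, ← pow_mul] at h1
  rw [mul_comm e f]
  exact Nat.pow_right_injective le_rfl h1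

theorem TwoFactorsAs.mul_eq (h : TwoFactorsAs L e f g) : e * f * g = Module.finrank ℚ L := by
  obtain ⟨P, -, hP, h⟩ := h
  exact mul_mul_eq_finrank hP h

/-- The numerical data of the factorization are unique: the factors are exactly the primes
above `2`, which gives `g` and `f`, and `e` is then forced by the fundamental identity. -/
theorem TwoFactorsAs.unique {e' f' g' : ℕ} (h : TwoFactorsAs L e f g)
    (h' : TwoFactorsAs L e' f' g') : e = e' ∧ f = f' ∧ g = g' := by
  have hm := h.mul_eq
  have hm' := h'.mul_eq
  obtain ⟨P, hinj, hP, h⟩ := h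
  obtain ⟨P', hinj', hP', h'⟩ := h'
  have hr : Set.range P = Set.range P' := by
    ext Q
    constructor
    · rintro ⟨i, rfl⟩
      exact exists_eq_factor (fun i => (hP' i).1) h' (hP i).1 (two_mem_factor h i)
    · rintro ⟨i, rfl⟩
      exact exists_eq_factor (fun i => (hP i).1) h (hP' i).1 (two_mem_factor h' i)
  have hg : g = g' := by
    have := congrArg Set.ncard hr
    rwa [← Set.image_univ, ← Set.image_univ, Set.ncard_image_of_injective _ hinj,
      Set.ncard_image_of_injective _ hinj', Set.ncard_univ, Set.ncard_univ, Nat.card_fin,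
      Nat.card_fin] at this
  have hf : f = f' := by
    obtain ⟨i, hi⟩ : P ⟨0, Nat.pos_of_ne_zero (card_ne_zero h)⟩ ∈ Set.range P' := by
      rw [← hr]
      exact ⟨_, rfl⟩
    rw [← (hP _).2, ← hi, (hP' _).2]
  subst hg hf
  refine ⟨?_, rfl, rfl⟩
  have hpos := Module.finrank_pos (R := ℚ) (M := L)
  rw [← hm, mul_assoc] at hpos
  rw [← hm', mul_assoc, mul_assoc] at hm
  exact Nat.eq_of_mul_eq_mul_right (Nat.pos_of_mul_pos_left hpos) hm

/-- If `2` times an element prime to some `𝔭` above `2` is a `k`-th power, then `k` divides the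
ramification index: compare exponents of `𝔭`. -/
theorem dvd_exponent (hinj : Function.Injective P) (hP : ∀ i, (P i).IsPrime)
    (h : Ideal.span {(2 : 𝓞 L)} = ∏ i, P i ^ e) (i : Fin g) {k : ℕ} {γ η : 𝓞 L}
    (hγ : γ ^ k = 2 * η) (hη : η ∉ P i) : k ∣ e := by
  have hbot : ∀ j, P j ≠ ⊥ := by
    intro j hb
    have := two_mem_factor h j
    rw [hb] at this
    simp at this
  have hprime : ∀ j, Prime (P j) := fun j => Ideal.prime_of_isPrime (hbot j) (hP j)
  have hη0 : emultiplicity (P i) (Ideal.span {η}) = 0 := by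
    rw [emultiplicity_eq_zero, Ideal.dvd_span_singleton]
    exact hη
  have h2 : emultiplicity (P i) (Ideal.span {(2 : 𝓞 L)}) = e := by
    rw [h, Finset.emultiplicity_prod (hprime i), Finset.sum_eq_single i]
    · exact emultiplicity_pow_self (hbot i) (hprime i).not_isUnit e
    · intro j _ hj
      rw [emultiplicity_pow (hprime i), emultiplicity_eq_zero.2, mul_zero]
      intro hd
      refine hj (hinj ?_)
      exact (((hP j).isMaximal (hbot j)).eq_of_le (hP i).ne_top (Ideal.le_of_dvd hd))
    · simp
  have h3 := congrArg (fun x => emultiplicity (P i) (Ideal.span {x})) hγ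
  simp only [← Ideal.span_singleton_pow, ← Ideal.span_singleton_mul_span_singleton] at h3
  rw [emultiplicity_pow (hprime i), emultiplicity_mul (hprime i), hη0, h2, add_zero] at h3
  -- an infinite multiplicity, that is `γ = 0`, is excluded unless `k = 0`
  rcases eq_or_ne (emultiplicity (P i) (Ideal.span {γ})) ⊤ with h4 | h4
  · rcases Nat.eq_zero_or_pos k with rfl | hk
    · rw [Nat.cast_zero, zero_mul] at h3
      exact ⟨0, by rw [zero_mul]; exact_mod_cast h3.symm⟩
    · rw [h4, ENat.mul_top (by exact_mod_cast hk.ne')] at h3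
      exact absurd h3.symm (ENat.natCast_ne_top _)
  · obtain ⟨n, hn⟩ := ENat.ne_top_iff_exists.1 h4
    rw [← hn] at h3
    exact ⟨n, by exact_mod_cast h3.symm⟩

variable (L) in
/-- In a Galois extension all primes above `2` have the same ramification index and the same residue
degree, so a factorization of the required shape exists. -/
theorem exists_twoFactorsAs [IsGalois ℚ L] : ∃ e f g : ℕ, TwoFactorsAs L e f g := by
  classical
  have hmax : (Ideal.span {(2 : ℤ)}).IsMaximal :=
    PrincipalIdealRing.isMaximal_of_irreducible Int.prime_two.irreducible
  have h := Ideal.map_algebraMap_eq_finsetProd_pow (R := 𝓞 L) (p := Ideal.span {(2 : ℤ)}) (by simp)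
  rw [Ideal.map_span, Set.image_singleton, map_ofNat] at h
  set S := (Ideal.primesOver (Ideal.span {(2 : ℤ)}) (𝓞 L)).toFinset with hS
  have hmem : ∀ Q ∈ S, Q.IsPrime ∧ Q.LiesOver (Ideal.span {(2 : ℤ)}) := fun Q hQ => by
    rwa [hS, Set.mem_toFinset] at hQ
  refine ⟨(Ideal.span {(2 : ℤ)}).ramificationIdxIn (𝓞 L),
    (Ideal.span {(2 : ℤ)}).inertiaDegIn (𝓞 L), S.card, fun i => S.equivFin.symm i,
    fun i j hij => S.equivFin.symm.injective (Subtype.ext hij), fun i => ?_, ?_⟩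
  · obtain ⟨h1, h2⟩ := hmem _ (S.equivFin.symm i).2
    exact ⟨h1, (Ideal.inertiaDegIn_eq_inertiaDeg _ _ Gal(L/ℚ)).symm⟩
  · rw [h, ← Finset.prod_coe_sort, ← S.equivFin.symm.prod_comp]
    refine Finset.prod_congr rfl fun i _ => ?_
    obtain ⟨h1, h2⟩ := hmem _ (S.equivFin.symm i).2
    rw [Ideal.ramificationIdxIn_eq_ramificationIdx (Ideal.span {(2 : ℤ)})
      (S.equivFin.symm i : Ideal (𝓞 L)) Gal(L/ℚ)]

end Factorization

/-! ### Square roots in `L` and lower bounds for `e`, `f` and `g` -/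

section Criteria

variable {L : Type*} [Field L]

/-- Being a square in a field depends on an integer only through its square class. -/
theorem isSquare_intCast_of_sq_mul [CharZero L] {n d : ℤ} (hn : n ≠ 0)
    (h : IsSquare ((n ^ 2 * d : ℤ) : L)) : IsSquare (d : L) := by
  obtain ⟨x, hx⟩ := h
  have hn' : (n : L) ≠ 0 := Int.cast_ne_zero.2 hn
  refine ⟨x / n, ?_⟩
  push_cast at hx
  field_simp
  linear_combination hx

theorem exists_integer_sq_eq {d : ℤ} (h : IsSquare (d : L)) : ∃ A : 𝓞 L, A ^ 2 = d := by
  obtain ⟨x, hx⟩ := h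
  have hi : IsIntegral ℤ x := .of_pow two_pos (by
    rw [sq, ← hx]
    exact isIntegral_algebraMap (R := ℤ) (x := d))
  obtain ⟨A, rfl⟩ := (IsIntegralClosure.isIntegral_iff (A := 𝓞 L)).1 hi
  refine ⟨A, RingOfIntegers.coe_injective ?_⟩
  rw [map_pow, map_intCast, hx, sq]

/-- For `d ≡ 1 mod 4`, half of `1 + √d` is an algebraic integer. -/
theorem exists_integer_sq_eq_add {d k : ℤ} (hd : d = 4 * k + 1) [CharZero L]
    (h : IsSquare (d : L)) : ∃ ω : 𝓞 L, ω ^ 2 = ω + k ∧ (2 * ω - 1) ^ 2 = d := by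
  obtain ⟨x, hx⟩ := h
  have h1 : ((1 + x) / 2) ^ 2 = (1 + x) / 2 + (k : L) := by
    rw [hd] at hx
    push_cast at hx
    linear_combination -hx / 4
  have hi : IsIntegral ℤ ((1 + x) / 2) := by
    refine ⟨X ^ 2 - (X + C k), ?_, ?_⟩
    · refine monic_X_pow_sub ?_
      compute_degree!
    · rw [eval₂_sub, eval₂_add, eval₂_X_pow, eval₂_X, eval₂_C, h1]
      simp
  obtain ⟨ω, hω⟩ := (IsIntegralClosure.isIntegral_iff (A := 𝓞 L)).1 hi
  have h2 : ω ^ 2 = ω + (k : 𝓞 L) := by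
    refine RingOfIntegers.coe_injective ?_
    rw [map_pow, map_add, map_intCast, hω, h1]
  refine ⟨_, h2, ?_⟩
  rw [hd]
  push_cast
  linear_combination 4 * h2

/-- If `u ≡ 3 mod 4`, then `m + √u` has odd norm `m ^ 2 - u` for every even `m`. -/
theorem even_add_sqrt_notMem {Q : Ideal (𝓞 L)} (hQ : Q.IsPrime) (h2 : (2 : 𝓞 L) ∈ Q)
    {A : 𝓞 L} {u m : ℤ} (hu : Odd u) (hm : Even m) (hA : A ^ 2 = u) : (m : 𝓞 L) + A ∉ Q := by
  intro h
  have h1 : (((m ^ 2 - u : ℤ)) : 𝓞 L) ∈ Q := by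
    have h3 := Q.mul_mem_right ((m : 𝓞 L) - A) h
    have h4 : ((m ^ 2 - u : ℤ) : 𝓞 L) = (m + A) * (m - A) := by
      push_cast
      linear_combination hA
    rwa [h4]
  refine intCast_notMem_of_odd hQ h2 (n := m ^ 2 - u) ?_ h1
  exact (hm.pow_of_ne_zero two_ne_zero).sub_odd hu

variable [NumberField L] {e f g : ℕ}

/-- `2` ramifies in `ℚ(√u)` for `u ≡ 3 mod 4`, because `(1 + √u) ^ 2` is twice an element
of odd norm. -/
theorem TwoFactorsAs.two_dvd_of_isSquare_three_mod_four (h : TwoFactorsAs L e f g) {u : ℤ}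
    (hu : u % 4 = 3) (hs : IsSquare (u : L)) : 2 ∣ e := by
  obtain ⟨P, hinj, hP, h⟩ := h
  obtain ⟨A, hA⟩ := exists_integer_sq_eq hs
  obtain ⟨q, rfl⟩ : ∃ q, u = 4 * q + 3 := ⟨u / 4, by omega⟩
  let i : Fin g := ⟨0, Nat.pos_of_ne_zero (card_ne_zero h)⟩
  refine dvd_exponent hinj (fun i => (hP i).1) h i (γ := 1 + A) (η := (2 * q + 2 : ℤ) + A) ?_
    (even_add_sqrt_notMem (hP i).1 (two_mem_factor h i) (by grind) (by grind) hA)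
  push_cast at hA ⊢
  linear_combination hA

theorem TwoFactorsAs.two_dvd_of_isSquare_two_mul (h : TwoFactorsAs L e f g) {w : ℤ}
    (hw : Odd w) (hs : IsSquare ((2 * w : ℤ) : L)) : 2 ∣ e := by
  obtain ⟨P, hinj, hP, h⟩ := h
  obtain ⟨B, hB⟩ := exists_integer_sq_eq hs
  let i : Fin g := ⟨0, Nat.pos_of_ne_zero (card_ne_zero h)⟩
  refine dvd_exponent hinj (fun i => (hP i).1) h i (γ := B) (η := (w : ℤ)) ?_
    (intCast_notMem_of_odd (hP i).1 (two_mem_factor h i) hw)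
  rw [hB]
  push_cast
  ring

/-- For `u ≡ 3 mod 4` and `w` odd, `2` is totally ramified in `ℚ(√u, √(2w))`. With
`β = √(2w) (1 + √u) / 2`, one has `β ^ 2 = w ((1 + u) / 2 + √u)`, and `(β - 1) ^ 4` is twice
an element prime to `2`. -/
theorem TwoFactorsAs.four_dvd (h : TwoFactorsAs L e f g) {u w : ℤ} (hu : u % 4 = 3)
    (hw : Odd w) (hsu : IsSquare (u : L)) (hsw : IsSquare ((2 * w : ℤ) : L)) : 4 ∣ e := by
  obtain ⟨P, hinj, hP, h⟩ := h
  obtain ⟨A, hA⟩ := exists_integer_sq_eq hsu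
  obtain ⟨B, hB⟩ := exists_integer_sq_eq hsw
  obtain ⟨q, rfl⟩ : ∃ q, u = 4 * q + 3 := ⟨u / 4, by omega⟩
  obtain ⟨v, rfl⟩ := hw
  let i : Fin g := ⟨0, Nat.pos_of_ne_zero (card_ne_zero h)⟩
  have h2 := two_mem_factor h i
  have hPi := (hP i).1
  obtain ⟨β, hβ⟩ : ∃ β : 𝓞 L, β ^ 2 = (2 * v + 1) * (2 * q + 2 + A) := by
    have hA' : (A : L) ^ 2 = 4 * q + 3 := by
      have := congrArg (algebraMap (𝓞 L) L) hA
      rw [map_pow, map_intCast] at this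
      exact_mod_cast this
    have hB' : (B : L) ^ 2 = 2 * (2 * v + 1) := by
      have := congrArg (algebraMap (𝓞 L) L) hB
      rw [map_pow, map_intCast] at this
      exact_mod_cast this
    have hβ : ((B : L) * (1 + A) / 2) ^ 2 =
        (((2 * v + 1) * (2 * q + 2 + A) : 𝓞 L) : L) := by
      simp only [map_mul, map_add, map_ofNat, map_intCast, map_one]
      linear_combination (1 + (A : L)) ^ 2 / 4 * hB' + (2 * (v : L) + 1) / 2 * hA'
    have hi : IsIntegral ℤ ((B : L) * (1 + A) / 2) := .of_pow two_pos (by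
      rw [hβ]
      exact RingOfIntegers.isIntegral_coe _)
    obtain ⟨β, hβ'⟩ := (IsIntegralClosure.isIntegral_iff (A := 𝓞 L)).1 hi
    exact ⟨β, RingOfIntegers.coe_injective (by rw [map_pow, hβ', hβ])⟩
  have hAi : A ∉ P i := by
    have := even_add_sqrt_notMem hPi h2 (m := 0) (by grind) (by grind) hA
    simpa using this
  have hs : (((2 * v + 1) * (2 * q + 2) + 1 : ℤ) : 𝓞 L) ∉ P i :=
    intCast_notMem_of_odd hPi h2 (by grind)
  have hv : ((2 * v + 1 : ℤ) : 𝓞 L) ∉ P i := intCast_notMem_of_odd hPi h2 (by grind)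
  -- the part of `(β - 1) ^ 4 / 2` which is visibly divisible by `2` is `2 * δ`
  let δ : 𝓞 L := 4 * (v ^ 2 + v) * q + 3 * (v ^ 2 + v) + q + 1
    + (2 * v + 1) ^ 2 * (q + 1) ^ 2 + (2 * v + 1) * (q + 1)
    - β * ((2 * v + 1) * A + ((2 * v + 1) * (2 * q + 2) + 1)) + β ^ 2
  refine dvd_exponent hinj (fun i => (hP i).1) h i (γ := β - 1)
    (η := ((2 * v + 1) * (2 * q + 2) + 1 : ℤ) * (2 * v + 1 : ℤ) * A + 2 * δ) ?_ ?_
  · have h1 : (β - 1) ^ 2 =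
        (2 * v + 1) * A + ((2 * v + 1) * (2 * q + 2) + 1) - 2 * β := by
      linear_combination hβ
    rw [show (β - 1) ^ 4 = ((β - 1) ^ 2) ^ 2 by ring, h1]
    push_cast at hA ⊢
    simp only [δ]
    linear_combination (2 * (v : 𝓞 L) + 1) ^ 2 * hA
  · intro hmem
    rw [Ideal.add_mem_iff_left _ ((P i).mul_mem_right _ h2)] at hmem
    rcases hPi.mem_or_mem hmem with h3 | h3
    · exact (hPi.mem_or_mem h3).elim hs hv
    · exact hAi h3

/-- If `ℚ(√d) ⊆ L` with `d ≡ 5 mod 8`, then the residue fields above `2` contain a root of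
`x ^ 2 + x + 1`, so their degrees are even. -/
theorem TwoFactorsAs.two_dvd_inertiaDeg (h : TwoFactorsAs L e f g) {d : ℤ} (hd : d % 8 = 5)
    (hs : IsSquare (d : L)) : 2 ∣ f := by
  obtain ⟨P, -, hP, h⟩ := h
  obtain ⟨q, rfl⟩ : ∃ q, d = 8 * q + 5 := ⟨d / 8, by omega⟩
  obtain ⟨ω, hω, -⟩ := exists_integer_sq_eq_add (k := 2 * q + 1) (by ring) hs
  let i : Fin g := ⟨0, Nat.pos_of_ne_zero (card_ne_zero h)⟩
  have h2 := two_mem_factor h i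
  have hPi := (hP i).1
  have hcard : Nat.card (𝓞 L ⧸ P i) = 2 ^ f := by
    rw [← (hP i).2, ← absNorm_eq_two_pow hPi h2, Ideal.absNorm_apply, Submodule.cardQuot_apply]
  have hfin : Finite (𝓞 L ⧸ P i) := Nat.finite_of_card_ne_zero (by rw [hcard]; positivity)
  have hfield := Finite.isDomain_to_isField (𝓞 L ⧸ P i)
  let := hfield.toField
  let := Fintype.ofFinite (𝓞 L ⧸ P i)
  set x : 𝓞 L ⧸ P i := Ideal.Quotient.mk (P i) ω with hx
  have h20 : (2 : 𝓞 L ⧸ P i) = 0 := by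
    rw [← Ideal.Quotient.eq_zero_iff_mem.2 h2, map_ofNat]
  have hx2 : x ^ 2 = x + 1 := by
    have := congrArg (Ideal.Quotient.mk (P i)) hω
    simp only [map_pow, map_add, map_intCast] at this
    push_cast at this
    rw [hx]
    linear_combination this + (q : 𝓞 L ⧸ P i) * h20
  have hx3 : x ^ 3 = 1 := by linear_combination (x + 1) * hx2 + x * h20
  have hpow : x ^ (2 ^ f) = x := by
    rw [← hcard, Nat.card_eq_fintype_card]
    exact FiniteField.pow_card x
  by_contra hf
  obtain ⟨j, rfl⟩ : ∃ j, f = 2 * j + 1 := ⟨f / 2, by omega⟩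
  -- `2 ^ f ≡ 2 mod 3` for odd `f`, so that `x ^ 2 = x`
  have h4 : 2 ^ (2 * j + 1) % 3 = 2 := by
    rw [pow_succ, pow_mul, Nat.mul_mod, Nat.pow_mod]
    norm_num
  rw [← Nat.div_add_mod (2 ^ (2 * j + 1)) 3, h4, pow_add, pow_mul, hx3, one_pow, one_mul,
    hx2] at hpow
  exact one_ne_zero (add_eq_left.1 hpow)

/-- If `ℚ(√d) ⊆ L` is a quadratic field with `d ≡ 1 mod 8`, then `2` splits in `L`: the
integers `ω = (1 + √d) / 2` and `1 - ω` have even product, and are exchanged by an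
automorphism of `L`. -/
theorem TwoFactorsAs.two_le_card [IsGalois ℚ L] (h : TwoFactorsAs L e f g) {d : ℤ}
    (hd : d % 8 = 1) (hsq : ¬ IsSquare (d : ℚ)) (hs : IsSquare (d : L)) : 2 ≤ g := by
  obtain ⟨P, -, hP, h⟩ := h
  obtain ⟨q, rfl⟩ : ∃ q, d = 8 * q + 1 := ⟨d / 8, by omega⟩
  obtain ⟨ω, hω, hω'⟩ := exists_integer_sq_eq_add (k := 2 * q) (by ring) hs
  have hg := Nat.pos_of_ne_zero (card_ne_zero h)
  by_contra hlt
  obtain rfl : g = 1 := by omega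
  have h2 := two_mem_factor h 0
  have hP0 := (hP 0).1
  -- `√d = 2 * ω - 1` is irrational, so some automorphism moves it, necessarily to `-√d`
  obtain ⟨σ, hσ⟩ : ∃ σ : Gal(L/ℚ), σ (2 * ω - 1 : L) ≠ 2 * ω - 1 := by
    by_contra! hall
    obtain ⟨y, hy⟩ := IntermediateField.mem_bot.1 ((IsGalois.mem_bot_iff_fixed _).2 hall)
    refine hsq ⟨y, (algebraMap ℚ L).injective ?_⟩
    have := congrArg (algebraMap (𝓞 L) L) hω'
    simp only [map_pow, map_sub, map_mul, map_ofNat, map_one, map_intCast] at this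
    rw [map_mul, hy, ← sq, this, map_intCast]
  have hσω : RingOfIntegers.mapRingEquiv σ.toRingEquiv ω = 1 - ω := by
    refine RingOfIntegers.coe_injective ?_
    change σ (ω : L) = algebraMap (𝓞 L) L (1 - ω)
    rw [map_sub, map_one]
    have h3 : (2 * (ω : L) - 1) ^ 2 = (8 * q + 1 : ℤ) := by
      have := congrArg (algebraMap (𝓞 L) L) hω'
      simpa only [map_pow, map_sub, map_mul, map_ofNat, map_one, map_intCast] using this
    have h4 : σ (2 * ω - 1 : L) ^ 2 = (2 * (ω : L) - 1) ^ 2 := by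
      rw [← map_pow, h3, map_intCast]
    have h5 := (sq_eq_sq_iff_eq_or_eq_neg.1 h4).resolve_left hσ
    simp only [map_sub, map_mul, map_ofNat, map_one] at h5
    linear_combination h5 / 2
  -- the only prime above `2` is stable under `σ`, so that it contains both `ω` and `1 - ω`
  have hstable : (P 0).comap (RingOfIntegers.mapRingEquiv σ.toRingEquiv) = P 0 := by
    obtain ⟨i, hi⟩ := exists_eq_factor (fun i => (hP i).1) h
      (Q := (P 0).comap (RingOfIntegers.mapRingEquiv σ.toRingEquiv))
      (hP0.comap _) (by rwa [Ideal.mem_comap, map_ofNat])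
    rw [← hi, Subsingleton.elim i 0]
  have hprod : ω * (1 - ω) ∈ P 0 := by
    have h3 := (P 0).mul_mem_right (-(q : 𝓞 L)) h2
    have h4 : ω * (1 - ω) = 2 * -(q : 𝓞 L) := by
      push_cast at hω
      linear_combination -hω
    rwa [h4]
  have hiff : ω ∈ P 0 ↔ 1 - ω ∈ P 0 := by
    rw [← hσω, ← hstable, Ideal.mem_comap, hstable]
  have hboth : ω ∈ P 0 ∧ 1 - ω ∈ P 0 := by
    rcases hP0.mem_or_mem hprod with h3 | h3
    · exact ⟨h3, hiff.1 h3⟩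
    · exact ⟨hiff.2 h3, h3⟩
  refine hP0.ne_top ((Ideal.eq_top_iff_one _).2 ?_)
  simpa using (P 0).add_mem hboth.1 hboth.2

end Criteria

/-! ### Biquadratic fields and the splitting field of the second iterate -/

theorem finrank_adjoin_sqrt {F E : Type*} [Field F] [Field E] [Algebra F E] {x : E} {d : F}
    (hx : x ^ 2 = algebraMap F E d) (hd : ¬ IsSquare d) : Module.finrank F F⟮x⟯ = 2 := by
  have hirr : Irreducible (X ^ 2 - C d : F[X]) :=
    X_pow_sub_C_irreducible_of_prime Nat.prime_two fun y hy => hd ⟨y, by rw [← hy, sq]⟩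
  have hmonic : (X ^ 2 - C d : F[X]).Monic := monic_X_pow_sub_C d two_ne_zero
  have hroot : aeval x (X ^ 2 - C d : F[X]) = 0 := by simp [hx]
  rw [IntermediateField.adjoin.finrank ⟨_, hmonic, hroot⟩,
    ← minpoly.eq_of_irreducible_of_monic hirr hroot hmonic, natDegree_X_pow_sub_C]

theorem exists_eq_add_mul_of_mem_adjoin_sqrt {F E : Type*} [Field F] [Field E] [Algebra F E]
    {s y : E} {d : F} (hs : s ^ 2 = algebraMap F E d) (hy : y ∈ F⟮s⟯) :
    ∃ p q : F, y = algebraMap F E p + algebraMap F E q * s := by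
  have hint : IsIntegral F s := .of_pow two_pos (by rw [hs]; exact isIntegral_algebraMap)
  rw [← IntermediateField.mem_toSubalgebra,
    IntermediateField.adjoin_simple_toSubalgebra_of_isAlgebraic hint.isAlgebraic] at hy
  induction hy using Algebra.adjoin_induction with
  | mem x hx => exact ⟨0, 1, by simp [Set.mem_singleton_iff.1 hx]⟩
  | algebraMap r => exact ⟨r, 0, by simp⟩
  | add x y _ _ hx hy =>
    obtain ⟨p, q, rfl⟩ := hx
    obtain ⟨p', q', rfl⟩ := hy
    exact ⟨p + p', q + q', by simp only [map_add]; ring⟩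
  | mul x y _ _ hx hy =>
    obtain ⟨p, q, rfl⟩ := hx
    obtain ⟨p', q', rfl⟩ := hy
    refine ⟨p * p' + q * q' * d, p * q' + q * p', ?_⟩
    simp only [map_add, map_mul]
    linear_combination algebraMap F E q * algebraMap F E q' * hs

/-- The tower `F ⊆ F(s) ⊆ F(s, t)` has two quadratic steps: an element `p + q s` of `F(s)` whose
square lies in `F` has `p = 0` or `q = 0`, which would make `d * d'` or `d'` a square in `F`. -/
theorem finrank_eq_four {F E : Type*} [Field F] [CharZero F] [Field E] [Algebra F E] {s t : E}
    {d d' : F} (hs : s ^ 2 = algebraMap F E d) (ht : t ^ 2 = algebraMap F E d')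
    (hd : ¬ IsSquare d) (hd' : ¬ IsSquare d') (hdd : ¬ IsSquare (d * d'))
    (htop : IntermediateField.adjoin F {s, t} = ⊤) : Module.finrank F E = 4 := by
  have : CharZero E := charZero_of_injective_algebraMap (algebraMap F E).injective
  have hsF : ∀ p : F, s ≠ algebraMap F E p := fun p hp => hd ⟨p, (algebraMap F E).injective (by
    rw [← hs, hp, map_mul, sq])⟩
  have htF : ¬ IsSquare (algebraMap F F⟮s⟯ d') := by
    rintro ⟨y, hy⟩
    obtain ⟨p, q, hpq⟩ := exists_eq_add_mul_of_mem_adjoin_sqrt hs y.2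
    have h1 : algebraMap F E d' = (y : E) * y := by
      have := congrArg (algebraMap F⟮s⟯ E) hy
      rwa [← IsScalarTower.algebraMap_apply, map_mul] at this
    rw [hpq] at h1
    rcases eq_or_ne (2 * p * q) 0 with h0 | h0
    · rcases mul_eq_zero.1 h0 with h2 | rfl
      · obtain rfl : p = 0 := by simpa using h2
        refine hdd ⟨d * q, (algebraMap F E).injective ?_⟩
        simp only [map_mul]
        rw [h1, map_zero]
        linear_combination algebraMap F E d * algebraMap F E q ^ 2 * hs
      · exact hd' ⟨p, (algebraMap F E).injective (by rw [h1, map_mul, map_zero]; ring)⟩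
    · refine hsF ((d' - p ^ 2 - q ^ 2 * d) / (2 * p * q)) ?_
      have h0' : algebraMap F E (2 * p * q) ≠ 0 := by simpa using h0
      rw [map_div₀, eq_div_iff h0']
      simp only [map_mul, map_sub, map_pow, map_ofNat]
      linear_combination -h1 - algebraMap F E q ^ 2 * hs
  have h2 : Module.finrank F⟮s⟯ F⟮s⟯⟮t⟯ = 2 :=
    finrank_adjoin_sqrt (by rw [ht, ← IsScalarTower.algebraMap_apply]) htF
  have h3 : F⟮s⟯⟮t⟯ = ⊤ := by
    apply IntermediateField.restrictScalars_injective F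
    rw [IntermediateField.adjoin_simple_adjoin_simple, htop, IntermediateField.restrictScalars_top]
  rw [h3, IntermediateField.finrank_top'] at h2
  rw [← Module.finrank_mul_finrank F F⟮s⟯ E, finrank_adjoin_sqrt hs hd, h2]

theorem not_isSquare_sq_add_self {b : ℤ} (h0 : b ≠ 0) (h1 : b ≠ -1) :
    ¬ IsSquare (b ^ 2 + b) := by
  rintro ⟨r, hr⟩
  -- completing the square: `(2 * b + 1) ^ 2 - (2 * r) ^ 2 = 1`
  have h : (2 * b + 1 - 2 * r) * (2 * b + 1 + 2 * r) = 1 := by linear_combination 4 * hr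
  rcases Int.eq_one_or_neg_one_of_mul_eq_one' h with h | h <;> omega

theorem not_isSquare_sq_sub_one {b : ℤ} (h0 : b ≠ 1) (h1 : b ≠ -1) :
    ¬ IsSquare (b ^ 2 - 1) := by
  rintro ⟨r, hr⟩
  have h : (b - r) * (b + r) = 1 := by linear_combination hr
  rcases Int.eq_one_or_neg_one_of_mul_eq_one' h with h | h <;> omega

theorem fPolySecondIterate_eq_mul (b : ℤ) : fPolySecondIterate (-b ^ 2) =
    (X ^ 2 - C ((b ^ 2 + b : ℤ) : ℚ)) * (X ^ 2 - C ((b ^ 2 - b : ℤ) : ℚ)) := by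
  simp only [fPolySecondIterate, fPoly, add_comp, pow_comp, X_comp, C_comp]
  push_cast
  simp only [C_add, C_sub, C_neg, C_pow]
  ring

theorem Polynomial.Splits.exists_sq_eq {E : Type*} [Field E] {a : E}
    (h : (X ^ 2 - C a).Splits) : ∃ x : E, x ^ 2 = a := by
  obtain ⟨x, hx⟩ := h.exists_eval_eq_zero (by rw [degree_X_pow_sub_C two_pos]; norm_num)
  exact ⟨x, sub_eq_zero.1 (by simpa using hx)⟩

theorem exists_adjoin_eq_top (b : ℤ) (L : Type*) [Field L] [NumberField L]
    [IsSplittingField ℚ L (fPolySecondIterate (-b ^ 2))] :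
    ∃ s t : L, s ^ 2 = (b : L) ^ 2 + b ∧ t ^ 2 = (b : L) ^ 2 - b ∧
      IntermediateField.adjoin ℚ {s, t} = ⊤ := by
  have hsplit := IsSplittingField.splits L (fPolySecondIterate (-b ^ 2))
  have hadj := IsSplittingField.adjoin_rootSet L (fPolySecondIterate (-b ^ 2))
  have hmap : (fPolySecondIterate (-b ^ 2)).map (algebraMap ℚ L) =
      (X ^ 2 - C ((b : L) ^ 2 + b)) * (X ^ 2 - C ((b : L) ^ 2 - b)) := by
    rw [fPolySecondIterate_eq_mul]
    simp [Polynomial.map_mul]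
  have hne : ∀ a : L, (X ^ 2 - C a) ≠ 0 := fun a => X_pow_sub_C_ne_zero two_pos a
  rw [hmap, splits_mul (hne _) (hne _)] at hsplit
  obtain ⟨s, hs⟩ := hsplit.1.exists_sq_eq
  obtain ⟨t, ht⟩ := hsplit.2.exists_sq_eq
  refine ⟨s, t, hs, ht, ?_⟩
  have hsmem : s ∈ IntermediateField.adjoin ℚ {s, t} :=
    IntermediateField.subset_adjoin ℚ _ (by simp)
  have htmem : t ∈ IntermediateField.adjoin ℚ {s, t} :=
    IntermediateField.subset_adjoin ℚ _ (by simp)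
  rw [eq_top_iff, ← IntermediateField.toSubalgebra_le_toSubalgebra,
    IntermediateField.top_toSubalgebra, ← hadj, Algebra.adjoin_le_iff]
  intro x hx
  have hx' := (mem_rootSet.1 hx).2
  rw [aeval_def, ← eval_map, hmap, eval_mul, mul_eq_zero] at hx'
  simp only [eval_sub, eval_pow, eval_X, eval_C] at hx'
  rcases hx' with h | h <;> rw [sub_eq_zero] at h
  · rw [← hs, sq_eq_sq_iff_eq_or_eq_neg] at h
    rcases h with rfl | rfl
    exacts [hsmem, neg_mem hsmem]
  · rw [← ht, sq_eq_sq_iff_eq_or_eq_neg] at h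
    rcases h with rfl | rfl
    exacts [htmem, neg_mem htmem]

/-! ### Square classes attached to `b` -/

/-- The square class of the integer `d` is one of the three nontrivial classes of
`ℚ(√(b ^ 2 + b), √(b ^ 2 - b))`; the third one is that of `b ^ 2 - 1`. -/
def HasSquareClass (b d : ℤ) : Prop :=
  ∃ n : ℤ, n ≠ 0 ∧ (n ^ 2 * d = b ^ 2 + b ∨ n ^ 2 * d = b ^ 2 - b ∨ n ^ 2 * d = b ^ 2 - 1)

theorem hasSquareClass_neg {b d : ℤ} : HasSquareClass (-b) d ↔ HasSquareClass b d := by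
  refine exists_congr fun n => and_congr_right fun _ => ?_
  rw [neg_sq, ← sub_eq_add_neg, sub_neg_eq_add]
  tauto

theorem modEqPM_neg {n b a : ℤ} : ModEqPM n (-b) a ↔ ModEqPM n b a := by
  unfold ModEqPM
  rw [Int.neg_modEq_neg, ← Int.neg_modEq_neg (a := -b) (b := a), neg_neg, or_comm]

theorem eqPM_neg {b a : ℤ} : EqPM (-b) a ↔ EqPM b a := by
  unfold EqPM
  rw [neg_inj, neg_eq_iff_eq_neg, or_comm]

theorem cond411_neg {b : ℤ} : Cond411 (-b) ↔ Cond411 b := by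
  simp only [Cond411, modEqPM_neg, eqPM_neg]

theorem cond221_neg {b : ℤ} : Cond221 (-b) ↔ Cond221 b := by
  simp only [Cond221, modEqPM_neg, eqPM_neg]

theorem cond212_neg {b : ℤ} : Cond212 (-b) ↔ Cond212 b := by
  simp only [Cond212, modEqPM_neg, eqPM_neg]

theorem sq_two_pow (k : ℕ) : ((2 : ℤ) ^ k) ^ 2 = 4 ^ k := by
  rw [← pow_mul, mul_comm, pow_mul]
  norm_num

theorem exists_sixteen_mul {k : ℕ} (hk : 2 ≤ k) : ∃ m : ℤ, (4 : ℤ) ^ k = 16 * m := by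
  obtain ⟨j, rfl⟩ := Nat.exists_eq_add_of_le hk
  exact ⟨4 ^ j, by rw [pow_add]; norm_num⟩

theorem hasSquareClass_of_eq_pow_mul_add {b s : ℤ} {k : ℕ} (hb : b = 4 ^ k * s) :
    HasSquareClass b (s * (b + 1)) :=
  ⟨2 ^ k, by positivity, .inl (by rw [sq_two_pow, ← mul_assoc, ← hb]; ring)⟩

theorem hasSquareClass_of_eq_pow_mul_sub {b s : ℤ} {k : ℕ} (hb : b = 4 ^ k * s) :
    HasSquareClass b (s * (b - 1)) :=
  ⟨2 ^ k, by positivity, .inr (.inl (by rw [sq_two_pow, ← mul_assoc, ← hb]; ring))⟩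

theorem hasSquareClass_of_eq_one_add {b s : ℤ} {k : ℕ} (hb : b = 1 + 4 ^ k * s) :
    HasSquareClass b (s * b) :=
  ⟨2 ^ k, by positivity, .inr (.inl (by rw [sq_two_pow]; linear_combination -b * hb))⟩

/-- Here `b ^ 2 - 1 = (b - 1) * (b + 1)`, where `b + 1` is twice `1 + 4 ^ k * t`. -/
theorem hasSquareClass_of_eq_one_add_two_mul {b t : ℤ} {k : ℕ} (hb : b = 1 + 4 ^ k * (2 * t)) :
    HasSquareClass b (t * (1 + 4 ^ k * t)) :=
  ⟨2 ^ k * 2, by positivity, .inr (.inr (by rw [mul_pow, sq_two_pow, hb]; ring))⟩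

theorem hasSquareClass_sq_sub_one (b : ℤ) : HasSquareClass b (b ^ 2 - 1) :=
  ⟨1, one_ne_zero, by simp⟩

theorem exists_hasSquareClass_two_mul {b : ℤ} (hb : b % 4 = 1) :
    ∃ w, Odd w ∧ HasSquareClass b (2 * w) := by
  obtain ⟨q, rfl⟩ : ∃ q, b = 4 * q + 1 := ⟨b / 4, by omega⟩
  exact ⟨(4 * q + 1) * (2 * q + 1), by grind, 1, one_ne_zero, .inl (by ring)⟩

theorem sq_sub_one_mod_four {b : ℤ} (hb : Even b) : (b ^ 2 - 1) % 4 = 3 := by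
  obtain ⟨q, rfl⟩ := hb
  have : (q + q) ^ 2 = 4 * q ^ 2 := by ring
  omega

/-- One of the two kinds of square classes that force `2` to ramify always occurs: that of
`b ^ 2 - 1` if `b` is even, that of `b ^ 2 + b` or `b ^ 2 - b` if `b` is odd. -/
theorem exists_ramified_squareClass (b : ℤ) :
    (∃ u, u % 4 = 3 ∧ HasSquareClass b u) ∨ ∃ w, Odd w ∧ HasSquareClass b (2 * w) := by
  rcases Int.even_or_odd b with hb | hb
  · exact .inl ⟨_, sq_sub_one_mod_four hb, hasSquareClass_sq_sub_one b⟩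
  · right
    obtain h | h : b % 4 = 1 ∨ (-b) % 4 = 1 := by grind
    · exact exists_hasSquareClass_two_mul h
    · simpa only [hasSquareClass_neg] using exists_hasSquareClass_two_mul h

/-- When `b ≡ 1 mod 4`, the class of `b ^ 2 + b` is always that of twice an odd number; the
conditions on `s` make the class of `b ^ 2 - b`, respectively of `b ^ 2 - 1`,
congruent to `3` modulo `4`. -/
theorem exists_totallyRamified_squareClasses_of_eq_one_add {b s : ℤ} {k : ℕ} (hk : 1 ≤ k)
    (hb : b = 1 + 4 ^ k * s) (hs : s % 4 = 3 ∨ s % 8 = 6) :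
    ∃ u w, u % 4 = 3 ∧ Odd w ∧ HasSquareClass b u ∧ HasSquareClass b (2 * w) := by
  obtain ⟨j, rfl⟩ := Nat.exists_eq_add_of_le' hk
  have hb' : b % 4 = 1 := by
    rw [hb, pow_succ, mul_right_comm]
    omega
  obtain ⟨w, hw, hbw⟩ := exists_hasSquareClass_two_mul hb'
  rcases hs with hs | hs
  · refine ⟨_, w, ?_, hw, hasSquareClass_of_eq_one_add hb, hbw⟩
    rw [Int.mul_emod, hs, hb']
    norm_num
  · obtain ⟨t, rfl⟩ : ∃ t, s = 2 * t := ⟨s / 2, by omega⟩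
    refine ⟨_, w, ?_, hw, hasSquareClass_of_eq_one_add_two_mul hb, hbw⟩
    have h1 : t % 4 = 3 := by omega
    have h2 : (1 + (4 : ℤ) ^ (j + 1) * t) % 4 = 1 := by
      rw [pow_succ, mul_right_comm]
      omega
    rw [Int.mul_emod, h1, h2]
    norm_num

theorem EqPM.hasSquareClass_iff {b x d : ℤ} (h : EqPM b x) :
    HasSquareClass b d ↔ HasSquareClass x d := by
  rcases h with rfl | rfl
  · rfl
  · exact hasSquareClass_neg

theorem Cond411.exists_squareClasses {b : ℤ} (h : Cond411 b) :
    ∃ u w, u % 4 = 3 ∧ Odd w ∧ HasSquareClass b u ∧ HasSquareClass b (2 * w) := by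
  rcases h with h | h | ⟨j, r, h⟩ | ⟨k, r, hk, h⟩ | ⟨k, r, hk, h⟩
  · obtain ⟨x, hbx, hx⟩ : ∃ x, EqPM b x ∧ (x % 32 = 29 ∨ x % 32 = 25 ∨ x % 32 = 13) := by
      simp only [ModEqPM, Int.ModEq] at h
      obtain h | h : (b % 32 = 29 ∨ b % 32 = 25 ∨ b % 32 = 13) ∨
        ((-b) % 32 = 29 ∨ (-b) % 32 = 25 ∨ (-b) % 32 = 13) := by omega
      exacts [⟨b, .inl rfl, h⟩, ⟨-b, .inr (neg_neg b).symm, h⟩]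
    simp only [hbx.hasSquareClass_iff]
    exact exists_totallyRamified_squareClasses_of_eq_one_add
      (k := 1) (s := (x - 1) / 4) le_rfl (by omega) (by omega)
  · obtain ⟨x, hbx, hx⟩ : ∃ x, EqPM b x ∧ x % 64 = 49 := by
      simp only [ModEqPM, Int.ModEq] at h
      obtain h | h : b % 64 = 49 ∨ (-b) % 64 = 49 := by omega
      exacts [⟨b, .inl rfl, h⟩, ⟨-b, .inr (neg_neg b).symm, h⟩]
    simp only [hbx.hasSquareClass_iff]
    exact exists_totallyRamified_squareClasses_of_eq_one_add
      (k := 2) (s := (x - 1) / 16) one_le_two (by omega) (by omega)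
  · simp only [h.hasSquareClass_iff]
    set x : ℤ := 4 ^ j * (4 * r + 2) with hx
    have heven : Even x := ⟨4 ^ j * (2 * r + 1), by rw [hx]; ring⟩
    -- `x ^ 2 - 1 ≡ 3 mod 4`, and `x ^ 2 + x` has odd exponent of `2`
    refine ⟨_, (2 * r + 1) * (x + 1), sq_sub_one_mod_four heven,
      Odd.mul ⟨r, rfl⟩ heven.add_one, hasSquareClass_sq_sub_one x, ?_⟩
    convert hasSquareClass_of_eq_pow_mul_add hx using 1
    ring
  · simp only [h.hasSquareClass_iff]
    exact exists_totallyRamified_squareClasses_of_eq_one_add (by omega) rfl (by omega)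
  · simp only [h.hasSquareClass_iff]
    exact exists_totallyRamified_squareClasses_of_eq_one_add (by omega) rfl (by omega)

theorem mul_emod_eight {x y a c : ℤ} (hx : x % 8 = a) (hy : y % 8 = c) :
    x * y % 8 = a * c % 8 := by
  rw [Int.mul_emod, hx, hy]

theorem Cond221.exists_squareClass {b : ℤ} (h : Cond221 b) :
    ∃ d, d % 8 = 5 ∧ HasSquareClass b d := by
  rw [Cond221, ← or_assoc] at h
  rcases h with h | ⟨k, r, hk, h⟩ | ⟨k, r, hk, h⟩ | ⟨k, r, hk, h⟩
  · obtain ⟨x, hbx, hx⟩ :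
        ∃ x, EqPM b x ∧ (x % 32 = 4 ∨ x % 32 = 5 ∨ x % 64 = 9) := by
      simp only [ModEqPM, Int.ModEq] at h
      obtain h | h : (b % 32 = 4 ∨ b % 32 = 5 ∨ b % 64 = 9) ∨
        ((-b) % 32 = 4 ∨ (-b) % 32 = 5 ∨ (-b) % 64 = 9) := by omega
      exacts [⟨b, .inl rfl, h⟩, ⟨-b, .inr (neg_neg b).symm, h⟩]
    simp only [hbx.hasSquareClass_iff]
    rcases hx with hx | hx | hx
    · refine ⟨_, ?_, hasSquareClass_of_eq_pow_mul_add (k := 1) (s := x / 4) (by omega)⟩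
      exact mul_emod_eight (a := 1) (c := 5) (by omega) (by omega)
    · refine ⟨_, ?_, hasSquareClass_of_eq_one_add (k := 1) (s := (x - 1) / 4) (by omega)⟩
      exact mul_emod_eight (a := 1) (c := 5) (by omega) (by omega)
    · refine ⟨_, ?_, hasSquareClass_of_eq_one_add_two_mul (k := 1) (t := (x - 1) / 8) (by omega)⟩
      exact mul_emod_eight (a := 1) (c := 5) (by omega) (by omega)
  all_goals
    simp only [h.hasSquareClass_iff]
    obtain ⟨m, hm⟩ := exists_sixteen_mul hk
  · refine ⟨_, ?_, hasSquareClass_of_eq_pow_mul_sub rfl⟩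
    rw [hm, mul_assoc]
    exact mul_emod_eight (a := 3) (c := 7) (by omega) (by omega)
  · refine ⟨_, ?_, hasSquareClass_of_eq_one_add rfl⟩
    rw [hm, mul_assoc]
    exact mul_emod_eight (a := 5) (c := 1) (by omega) (by omega)
  · have heq : (1 : ℤ) + 4 ^ k * (16 * r + 10) = 1 + 4 ^ k * (2 * (8 * r + 5)) := by ring
    refine ⟨_, ?_, hasSquareClass_of_eq_one_add_two_mul heq⟩
    rw [hm, mul_assoc]
    exact mul_emod_eight (a := 5) (c := 1) (by omega) (by omega)

theorem Cond212.exists_squareClass {b : ℤ} (h : Cond212 b) :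
    ∃ d, d % 8 = 1 ∧ HasSquareClass b d := by
  rw [Cond212, ← or_assoc] at h
  rcases h with h | ⟨k, r, hk, h⟩ | ⟨k, r, hk, h⟩ | ⟨k, r, hk, h⟩
  · obtain ⟨x, hbx, hx⟩ :
        ∃ x, EqPM b x ∧ (x % 32 = 12 ∨ x % 32 = 21 ∨ x % 64 = 41) := by
      simp only [ModEqPM, Int.ModEq] at h
      obtain h | h : (b % 32 = 12 ∨ b % 32 = 21 ∨ b % 64 = 41) ∨
        ((-b) % 32 = 12 ∨ (-b) % 32 = 21 ∨ (-b) % 64 = 41) := by omega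
      exacts [⟨b, .inl rfl, h⟩, ⟨-b, .inr (neg_neg b).symm, h⟩]
    simp only [hbx.hasSquareClass_iff]
    rcases hx with hx | hx | hx
    · refine ⟨_, ?_, hasSquareClass_of_eq_pow_mul_sub (k := 1) (s := x / 4) (by omega)⟩
      exact mul_emod_eight (a := 3) (c := 3) (by omega) (by omega)
    · refine ⟨_, ?_, hasSquareClass_of_eq_one_add (k := 1) (s := (x - 1) / 4) (by omega)⟩
      exact mul_emod_eight (a := 5) (c := 5) (by omega) (by omega)
    · refine ⟨_, ?_, hasSquareClass_of_eq_one_add_two_mul (k := 1) (t := (x - 1) / 8) (by omega)⟩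
      exact mul_emod_eight (a := 5) (c := 5) (by omega) (by omega)
  all_goals
    simp only [h.hasSquareClass_iff]
    obtain ⟨m, hm⟩ := exists_sixteen_mul hk
  · refine ⟨_, ?_, hasSquareClass_of_eq_pow_mul_add rfl⟩
    rw [hm, mul_assoc]
    exact mul_emod_eight (a := 1) (c := 1) (by omega) (by omega)
  · refine ⟨_, ?_, hasSquareClass_of_eq_one_add rfl⟩
    rw [hm, mul_assoc]
    exact mul_emod_eight (a := 1) (c := 1) (by omega) (by omega)
  · have heq : (1 : ℤ) + 4 ^ k * (16 * r + 2) = 1 + 4 ^ k * (2 * (8 * r + 1)) := by ring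
    refine ⟨_, ?_, hasSquareClass_of_eq_one_add_two_mul heq⟩
    rw [hm, mul_assoc]
    exact mul_emod_eight (a := 1) (c := 1) (by omega) (by omega)

/-- The exact power of `4` is extracted, so that `s` may still be even. -/
theorem exists_eq_four_pow_mul {a : ℤ} (ha : a ≠ 0) :
    ∃ (k : ℕ) (s : ℤ), a = 4 ^ k * s ∧ s % 4 ≠ 0 := by
  obtain ⟨s, hs, hd⟩ := (Int.finiteMultiplicity_iff (a := 4) (b := a)).2
    ⟨by norm_num, ha⟩ |>.exists_eq_pow_mul_and_not_dvd
  exact ⟨_, s, hs, fun h => hd (Int.dvd_of_emod_eq_zero h)⟩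

theorem cond_of_even {b : ℤ} (hb : Even b) (h0 : b ≠ 0) : Cond411 b ∨ Cond221 b ∨ Cond212 b := by
  obtain ⟨k, s, hbs, hs⟩ := exists_eq_four_pow_mul h0
  rcases Int.even_or_odd s with h2 | h2
  · obtain ⟨r, hr⟩ : ∃ r, s = 4 * r + 2 := ⟨s / 4, by grind⟩
    exact .inl (.inr (.inr (.inl ⟨k, r, .inl (by rw [hbs, hr])⟩)))
  have hs8 : s % 8 = 1 ∨ s % 8 = 3 ∨ s % 8 = 5 ∨ s % 8 = 7 := by grind
  obtain rfl | rfl | hk : k = 0 ∨ k = 1 ∨ 2 ≤ k := by omega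
  · grind
  · rw [pow_one] at hbs
    simp only [Cond221, Cond212, ModEqPM, Int.ModEq]
    omega
  · rcases hs8 with h | h | h | h
    · obtain ⟨r, rfl⟩ : ∃ r, s = 8 * r + 1 := ⟨s / 8, by omega⟩
      exact .inr (.inr (.inr (.inr (.inl ⟨k, r, hk, .inl hbs⟩))))
    · obtain ⟨r, rfl⟩ : ∃ r, s = 8 * r + 3 := ⟨s / 8, by omega⟩
      exact .inr (.inl (.inr (.inr (.inl ⟨k, r, hk, .inl hbs⟩))))
    · obtain ⟨r, rfl⟩ : ∃ r, s = -(8 * r + 3) := ⟨-s / 8, by omega⟩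
      exact .inr (.inl (.inr (.inr (.inl ⟨k, r, hk, .inr (by rw [hbs, mul_neg])⟩))))
    · obtain ⟨r, rfl⟩ : ∃ r, s = -(8 * r + 1) := ⟨-s / 8, by omega⟩
      exact .inr (.inr (.inr (.inr (.inl ⟨k, r, hk, .inr (by rw [hbs, mul_neg])⟩))))

theorem cond_of_mod_four_eq_one {b : ℤ} (hb : b % 4 = 1) (h1 : b ≠ 1) :
    Cond411 b ∨ Cond221 b ∨ Cond212 b := by
  obtain ⟨k, s, hbs, hs⟩ := exists_eq_four_pow_mul (sub_ne_zero.2 h1)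
  obtain rfl | rfl | hk : k = 0 ∨ k = 1 ∨ 2 ≤ k := by omega
  · omega
  · simp only [Cond411, Cond221, Cond212, ModEqPM, Int.ModEq]
    omega
  replace hbs : b = 1 + 4 ^ k * s := by rw [← hbs]; ring
  have hcases : s % 4 = 3 ∨ s % 8 = 6 ∨ s % 8 = 5 ∨ s % 16 = 10 ∨ s % 8 = 1 ∨ s % 16 = 2 := by
    omega
  rcases hcases with h | h | h | h | h | h
  · obtain ⟨r, rfl⟩ : ∃ r, s = 4 * r + 3 := ⟨s / 4, by omega⟩
    exact .inl (.inr (.inr (.inr (.inl ⟨k, r, hk, .inl hbs⟩))))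
  · obtain ⟨r, rfl⟩ : ∃ r, s = 8 * r + 6 := ⟨s / 8, by omega⟩
    exact .inl (.inr (.inr (.inr (.inr ⟨k, r, hk, .inl hbs⟩))))
  · obtain ⟨r, rfl⟩ : ∃ r, s = 8 * r + 5 := ⟨s / 8, by omega⟩
    exact .inr (.inl (.inr (.inr (.inr (.inl ⟨k, r, hk, .inl hbs⟩)))))
  · obtain ⟨r, rfl⟩ : ∃ r, s = 16 * r + 10 := ⟨s / 16, by omega⟩
    exact .inr (.inl (.inr (.inr (.inr (.inr ⟨k, r, hk, .inl hbs⟩)))))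
  · obtain ⟨r, rfl⟩ : ∃ r, s = 8 * r + 1 := ⟨s / 8, by omega⟩
    exact .inr (.inr (.inr (.inr (.inr (.inl ⟨k, r, hk, .inl hbs⟩)))))
  · obtain ⟨r, rfl⟩ : ∃ r, s = 16 * r + 2 := ⟨s / 16, by omega⟩
    exact .inr (.inr (.inr (.inr (.inr (.inr ⟨k, r, hk, .inl hbs⟩)))))

/-- The three lists of conditions exhaust all `b ≠ 0, ±1`. They are also mutually
exclusive, by the uniqueness of `(e, f, g)`. -/
theorem cond_cover {b : ℤ} (h0 : b ≠ 0) (h1 : b ≠ 1) (h2 : b ≠ -1) :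
    Cond411 b ∨ Cond221 b ∨ Cond212 b := by
  rcases Int.even_or_odd b with hb | hb
  · exact cond_of_even hb h0
  obtain h | h : b % 4 = 1 ∨ (-b) % 4 = 1 := by grind
  · exact cond_of_mod_four_eq_one h h1
  · have := cond_of_mod_four_eq_one h (by omega)
    rwa [cond411_neg, cond221_neg, cond212_neg] at this

/-! ### The decomposition of `2` -/

theorem HasSquareClass.isSquare {b d : ℤ} (h : HasSquareClass b d) {L : Type*} [Field L]
    [CharZero L] {s t : L} (hs : s ^ 2 = (b : L) ^ 2 + b) (ht : t ^ 2 = (b : L) ^ 2 - b)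
    (hb : b ≠ 0) : IsSquare (d : L) := by
  obtain ⟨n, hn, h | h | h⟩ := h
  · exact isSquare_intCast_of_sq_mul hn ⟨s, by rw [h, ← sq, hs]; push_cast; rfl⟩
  · exact isSquare_intCast_of_sq_mul hn ⟨t, by rw [h, ← sq, ht]; push_cast; rfl⟩
  · refine isSquare_intCast_of_sq_mul hn ⟨s * t / b, ?_⟩
    have hb' : (b : L) ≠ 0 := Int.cast_ne_zero.2 hb
    rw [h]
    push_cast
    field_simp
    rw [hs, ht]
    ring

theorem HasSquareClass.not_isSquare {b d : ℤ} (h : HasSquareClass b d) (h0 : b ≠ 0)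
    (h1 : b ≠ 1) (h2 : b ≠ -1) : ¬ IsSquare (d : ℚ) := by
  rw [Rat.isSquare_intCast_iff]
  rintro ⟨r, rfl⟩
  obtain ⟨n, -, h | h | h⟩ := h
  · exact not_isSquare_sq_add_self h0 h2 ⟨n * r, by rw [← h]; ring⟩
  · refine not_isSquare_sq_add_self (b := -b) (by omega) (by omega) ⟨n * r, ?_⟩
    linear_combination -h
  · exact not_isSquare_sq_sub_one h1 h2 ⟨n * r, by rw [← h]; ring⟩

theorem mainTheorem4 (b c : ℤ) (hc : c = -b ^ 2) (hc0 : c ≠ 0) (hc1 : c ≠ -1)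
    (L : Type*) [Field L] [NumberField L]
    [IsSplittingField ℚ L (fPolySecondIterate c)] :
    (∃ s t : L, s ^ 2 = (b : L) ^ 2 + b ∧ t ^ 2 = (b : L) ^ 2 - b ∧
      IntermediateField.adjoin ℚ {s, t} = ⊤ ∧ Module.finrank ℚ L = 4) ∧
    (TwoFactorsAs L 4 1 1 ↔ Cond411 b) ∧
    (TwoFactorsAs L 2 2 1 ↔ Cond221 b) ∧
    (TwoFactorsAs L 2 1 2 ↔ Cond212 b) ∧
    (∀ e f g : ℕ, TwoFactorsAs L e f g →
      (e, f, g) = (4, 1, 1) ∨ (e, f, g) = (2, 2, 1) ∨ (e, f, g) = (2, 1, 2)) ∧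
    (TwoFactorsAs L 4 1 1 ∨ TwoFactorsAs L 2 2 1 ∨ TwoFactorsAs L 2 1 2) := by
  subst hc
  have h0 : b ≠ 0 := by
    rintro rfl
    exact hc0 (by norm_num)
  have h1 : b ≠ 1 := by
    rintro rfl
    exact hc1 (by norm_num)
  have h2 : b ≠ -1 := by
    rintro rfl
    exact hc1 (by norm_num)
  obtain ⟨s, t, hs, ht, htop⟩ := exists_adjoin_eq_top b L
  have hsquare : ∀ {d : ℤ}, HasSquareClass b d → IsSquare (d : L) := fun h => h.isSquare hs ht h0
  have hfinrank : Module.finrank ℚ L = 4 := by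
    refine finrank_eq_four (s := s) (t := t) (d := ((b ^ 2 + b : ℤ) : ℚ))
      (d' := ((b ^ 2 - b : ℤ) : ℚ)) (by rw [hs]; simp) (by rw [ht]; simp) ?_ ?_ ?_ htop
    · exact HasSquareClass.not_isSquare ⟨1, one_ne_zero, .inl (by ring)⟩ h0 h1 h2
    · exact HasSquareClass.not_isSquare ⟨1, one_ne_zero, .inr (.inl (by ring))⟩ h0 h1 h2
    · rw [← Int.cast_mul, show (b ^ 2 + b) * (b ^ 2 - b) = b ^ 2 * (b ^ 2 - 1) by ring]
      intro h
      refine (hasSquareClass_sq_sub_one b).not_isSquare h0 h1 h2 ?_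
      exact isSquare_intCast_of_sq_mul h0 h
  have : IsGalois ℚ L :=
    { to_normal := Normal.of_isSplittingField (fPolySecondIterate (-b ^ 2)) }
  obtain ⟨e, f, g, hT⟩ := exists_twoFactorsAs L
  have hefg := hT.mul_eq
  rw [hfinrank] at hefg
  have he : 2 ∣ e := by
    rcases exists_ramified_squareClass b with ⟨u, hu, h⟩ | ⟨w, hw, h⟩
    · exact hT.two_dvd_of_isSquare_three_mod_four hu (hsquare h)
    · exact hT.two_dvd_of_isSquare_two_mul hw (hsquare h)
  have h411 : Cond411 b → e = 4 ∧ f = 1 ∧ g = 1 := by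
    intro h
    obtain ⟨u, w, hu, hw, hbu, hbw⟩ := h.exists_squareClasses
    obtain ⟨a, rfl⟩ := hT.four_dvd hu hw (hsquare hbu) (hsquare hbw)
    have h3 : a * f * g = 1 := by linarith
    obtain ⟨⟨rfl, rfl⟩, rfl⟩ : (a = 1 ∧ f = 1) ∧ g = 1 := by simpa [mul_eq_one] using h3
    simp
  have h221 : Cond221 b → e = 2 ∧ f = 2 ∧ g = 1 := by
    intro h
    obtain ⟨d, hd, hbd⟩ := h.exists_squareClass
    obtain ⟨a, rfl⟩ := he
    obtain ⟨a', rfl⟩ := hT.two_dvd_inertiaDeg hd (hsquare hbd)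
    have h3 : a * a' * g = 1 := by linarith
    obtain ⟨⟨rfl, rfl⟩, rfl⟩ : (a = 1 ∧ a' = 1) ∧ g = 1 := by simpa [mul_eq_one] using h3
    simp
  have h212 : Cond212 b → e = 2 ∧ f = 1 ∧ g = 2 := by
    intro h
    obtain ⟨d, hd, hbd⟩ := h.exists_squareClass
    have hg := hT.two_le_card hd (hbd.not_isSquare h0 h1 h2) (hsquare hbd)
    obtain ⟨a, rfl⟩ := he
    have h3 : a * f * g = 2 := by linarith
    have h4 : g = 2 := le_antisymm (Nat.le_of_dvd two_pos (h3 ▸ dvd_mul_left _ _)) hg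
    subst h4
    have h5 : a * f = 1 := by linarith
    obtain ⟨rfl, rfl⟩ : a = 1 ∧ f = 1 := by simpa [mul_eq_one] using h5
    simp
  -- the converse implications hold because `b` satisfies one of the conditions and that one
  -- determines the triple
  have hcover := cond_cover h0 h1 h2
  refine ⟨⟨s, t, hs, ht, htop, hfinrank⟩, ⟨fun h => ?_, fun h => ?_⟩, ⟨fun h => ?_, fun h => ?_⟩,
    ⟨fun h => ?_, fun h => ?_⟩, fun e' f' g' h => ?_, ?_⟩
  · have := h.unique hT
    grind
  · obtain ⟨rfl, rfl, rfl⟩ := h411 h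
    exact hT
  · have := h.unique hT
    grind
  · obtain ⟨rfl, rfl, rfl⟩ := h221 h
    exact hT
  · have := h.unique hT
    grind
  · obtain ⟨rfl, rfl, rfl⟩ := h212 h
    exact hT
  · have := h.unique hT
    grind
  · rcases hcover with h | h | h
    · obtain ⟨rfl, rfl, rfl⟩ := h411 h
      exact .inl hT
    · obtain ⟨rfl, rfl, rfl⟩ := h221 h
      exact .inr (.inl hT)
    · obtain ⟨rfl, rfl, rfl⟩ := h212 h
      exact .inr (.inr hT)
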